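/- Let $Var$ be any set of propositional variables. The formulas of $\mathrm{FL}_{ew}$ are built from $Var$ and the constants $0,1$ with the binary connectives $\wedge,\vee,\cdot,\to$; put $\neg\varphi=\varphi\to 0$. $\mathrm{FL}_{ew}$ is the logic whose only rule is modus ponens and whose axiom schemas are \[ \begin{array}{ll} (\varphi\to\psi)\to((\psi\to\gamma)\to(\varphi\to\gamma)), & (\gamma\to\varphi)\to((\gamma\to\psi)\to(\gamma\to(\varphi\wedge\psi))),\\ (\varphi\wedge\psi)\to\varphi,\quad (\varphi\wedge\psi)\to\psi, & \varphi\to(\varphi\vee\psi),\quad \psi\to(\varphi\vee\psi),\\ (\varphi\to\gamma)\to((\psi\to\gamma)\to((\varphi\vee\psi)\to\gamma)), & (\varphi\cdot\psi)\to(\psi\cdot\varphi),\quad (\varphi\cdot\psi)\to\varphi,\\ (\varphi\to(\psi\to\gamma))\to((\varphi\cdot\psi)\to\gamma), & ((\varphi\cdot\psi)\to\gamma)\to(\varphi\to(\psi\to\gamma)),\\ 0\to\varphi,\quad \varphi\to 1. & \end{array} \] $\mathrm{FL}^B_{ew}$ is obtained by adding a unary connective $B$ to the language, taking all the above schemas and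 modus ponens in the expanded language, and adding the axiom schemas \[ B\varphi\to\varphi,\qquad B\varphi\vee\neg B\varphi,\qquad B(\varphi\vee\neg\varphi)\to(B\varphi\vee\neg\varphi),\qquad B(\varphi\to\psi)\to(B\varphi\to B\psi) \] and the rule: from $\varphi$ derive $B\varphi$ (also applicable to formulas derived from premises). Then $\mathrm{FL}^B_{ew}$ is a conservative expansion of $\mathrm{FL}_{ew}$: for every set $\Gamma\cup\{\varphi\}$ of $B$-free formulas, \[ \Gamma\vdash_{\mathrm{FL}^B_{ew}}\varphi\quad\text{if and only if}\quad \Gamma\vdash_{\mathrm{FL}_{ew}}\varphi . \] In particular (case $\Gamma=\emptyset$), every $B$-free formula derivable in $\mathrm{FL}^B_{ew}$ is already derivable in $\mathrm{FL}_{ew}$. -/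

import Mathlib

/-- Formulas of the logic FL_ew over a set `Var` of propositional variables: the language has the
binary connectives `∧`, `∨`, `·` (fusion), `→` and the constants `0`, `1`. -/
inductive FLewForm (Var : Type*) where
  | var (p : Var) : FLewForm Var
  | zero : FLewForm Var
  | one : FLewForm Var
  | and (φ ψ : FLewForm Var) : FLewForm Var
  | or (φ ψ : FLewForm Var) : FLewForm Var
  | fus (φ ψ : FLewForm Var) : FLewForm Var
  | imp (φ ψ : FLewForm Var) : FLewForm Var

namespace FLewForm

/-- The axioms of FL_ew (all instances of the axiom schemas). -/
inductive IsAxiom {Var : Type*} : FLewForm Var → Prop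
  | trans (φ ψ γ : FLewForm Var) :
      IsAxiom (imp (imp φ ψ) (imp (imp ψ γ) (imp φ γ)))
  | andIntro (φ ψ γ : FLewForm Var) :
      IsAxiom (imp (imp γ φ) (imp (imp γ ψ) (imp γ (and φ ψ))))
  | andLeft (φ ψ : FLewForm Var) : IsAxiom (imp (and φ ψ) φ)
  | andRight (φ ψ : FLewForm Var) : IsAxiom (imp (and φ ψ) ψ)
  | orLeft (φ ψ : FLewForm Var) : IsAxiom (imp φ (or φ ψ))
  | orRight (φ ψ : FLewForm Var) : IsAxiom (imp ψ (or φ ψ))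
  | orElim (φ ψ γ : FLewForm Var) :
      IsAxiom (imp (imp φ γ) (imp (imp ψ γ) (imp (or φ ψ) γ)))
  | fusComm (φ ψ : FLewForm Var) : IsAxiom (imp (fus φ ψ) (fus ψ φ))
  | fusLeft (φ ψ : FLewForm Var) : IsAxiom (imp (fus φ ψ) φ)
  | uncurry (φ ψ γ : FLewForm Var) :
      IsAxiom (imp (imp φ (imp ψ γ)) (imp (fus φ ψ) γ))
  | curry (φ ψ γ : FLewForm Var) :
      IsAxiom (imp (imp (fus φ ψ) γ) (imp φ (imp ψ γ)))
  | exFalso (φ : FLewForm Var) : IsAxiom (imp zero φ)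
  | toOne (φ : FLewForm Var) : IsAxiom (imp φ one)

/-- Finitary derivability from a set `Γ` of premises in FL_ew; the only rule is modus ponens. -/
inductive Derives {Var : Type*} (Γ : Set (FLewForm Var)) : FLewForm Var → Prop
  | hyp {φ : FLewForm Var} (h : φ ∈ Γ) : Derives Γ φ
  | ax {φ : FLewForm Var} (h : IsAxiom φ) : Derives Γ φ
  | mp {φ ψ : FLewForm Var} (h₁ : Derives Γ φ) (h₂ : Derives Γ (imp φ ψ)) : Derives Γ ψ

end FLewForm

/-- Formulas of the logic FL^B_ew: the language of FL_ew expanded with a unary connective `B`. -/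
inductive FLewBForm (Var : Type*) where
  | var (p : Var) : FLewBForm Var
  | zero : FLewBForm Var
  | one : FLewBForm Var
  | and (φ ψ : FLewBForm Var) : FLewBForm Var
  | or (φ ψ : FLewBForm Var) : FLewBForm Var
  | fus (φ ψ : FLewBForm Var) : FLewBForm Var
  | imp (φ ψ : FLewBForm Var) : FLewBForm Var
  | B (φ : FLewBForm Var) : FLewBForm Var

namespace FLewBForm

/-- The defined negation `¬ φ := φ → 0`. -/
def neg {Var : Type*} (φ : FLewBForm Var) : FLewBForm Var := imp φ zero

/-- The axioms of FL^B_ew: all instances, in the expanded language, of the axiom schemas of FL_ew,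
together with those of the four schemas `B1` – `B4`. -/
inductive IsAxiom {Var : Type*} : FLewBForm Var → Prop
  | trans (φ ψ γ : FLewBForm Var) :
      IsAxiom (imp (imp φ ψ) (imp (imp ψ γ) (imp φ γ)))
  | andIntro (φ ψ γ : FLewBForm Var) :
      IsAxiom (imp (imp γ φ) (imp (imp γ ψ) (imp γ (and φ ψ))))
  | andLeft (φ ψ : FLewBForm Var) : IsAxiom (imp (and φ ψ) φ)
  | andRight (φ ψ : FLewBForm Var) : IsAxiom (imp (and φ ψ) ψ)
  | orLeft (φ ψ : FLewBForm Var) : IsAxiom (imp φ (or φ ψ))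
  | orRight (φ ψ : FLewBForm Var) : IsAxiom (imp ψ (or φ ψ))
  | orElim (φ ψ γ : FLewBForm Var) :
      IsAxiom (imp (imp φ γ) (imp (imp ψ γ) (imp (or φ ψ) γ)))
  | fusComm (φ ψ : FLewBForm Var) : IsAxiom (imp (fus φ ψ) (fus ψ φ))
  | fusLeft (φ ψ : FLewBForm Var) : IsAxiom (imp (fus φ ψ) φ)
  | uncurry (φ ψ γ : FLewBForm Var) :
      IsAxiom (imp (imp φ (imp ψ γ)) (imp (fus φ ψ) γ))
  | curry (φ ψ γ : FLewBForm Var) :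
      IsAxiom (imp (imp (fus φ ψ) γ) (imp φ (imp ψ γ)))
  | exFalso (φ : FLewBForm Var) : IsAxiom (imp zero φ)
  | toOne (φ : FLewBForm Var) : IsAxiom (imp φ one)
  | B1 (φ : FLewBForm Var) : IsAxiom (imp (B φ) φ)
  | B2 (φ : FLewBForm Var) : IsAxiom (or (B φ) (neg (B φ)))
  | B3 (φ : FLewBForm Var) :
      IsAxiom (imp (B (or φ (neg φ))) (or (B φ) (neg φ)))
  | B4 (φ ψ : FLewBForm Var) : IsAxiom (imp (B (imp φ ψ)) (imp (B φ) (B ψ)))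

/-- Finitary derivability from a set `Γ` of premises in FL^B_ew; the rules are modus ponens and
"from `φ` derive `B φ`". -/
inductive Derives {Var : Type*} (Γ : Set (FLewBForm Var)) : FLewBForm Var → Prop
  | hyp {φ : FLewBForm Var} (h : φ ∈ Γ) : Derives Γ φ
  | ax {φ : FLewBForm Var} (h : IsAxiom φ) : Derives Γ φ
  | mp {φ ψ : FLewBForm Var} (h₁ : Derives Γ φ) (h₂ : Derives Γ (imp φ ψ)) : Derives Γ ψ
  | nec {φ : FLewBForm Var} (h : Derives Γ φ) : Derives Γ (B φ)

end FLewBForm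

/-- The inclusion of the language of FL_ew into that of FL^B_ew; its image consists of exactly the
`B`-free formulas. -/
def FLewForm.toFLewB {Var : Type*} : FLewForm Var → FLewBForm Var
  | .var p => .var p
  | .zero => .zero
  | .one => .one
  | .and φ ψ => .and φ.toFLewB ψ.toFLewB
  | .or φ ψ => .or φ.toFLewB ψ.toFLewB
  | .fus φ ψ => .fus φ.toFLewB ψ.toFLewB
  | .imp φ ψ => .imp φ.toFLewB ψ.toFLewB

/-! If `Γ` does not derive the `B`-free formula `φ`, Zorn's lemma extends it to a prime `Δ` that
still does not (`exists_isPrime_superset`). Over a prime set `B` can be read as a two-valued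
provability predicate: `elimB` replaces each `B ψ` by `1` or `0`. The axioms for `B` then become
derivable from `Δ`, and necessitation is sound. As `elimB` fixes `B`-free formulas, an FL^B_ew
derivation of `φ` from `Γ` would yield one in FL_ew from `Δ`. -/

namespace FLewForm

variable {Var : Type*} {Γ Δ : Set (FLewForm Var)} {φ ψ γ α β : FLewForm Var}

namespace Derives

theorem mono (h : Γ ⊆ Δ) (d : Derives Γ φ) : Derives Δ φ := by
  induction d with
  | hyp h' => exact .hyp (h h')
  | ax h' => exact .ax h'
  | mp _ _ ih₁ ih₂ => exact .mp ih₁ ih₂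

/-- Finitarity, in the form that is used with Zorn's lemma. -/
theorem exists_of_sUnion_chain {c : Set (Set (FLewForm Var))} (hc : IsChain (· ⊆ ·) c)
    (hne : c.Nonempty) (d : Derives (⋃₀ c) φ) : ∃ s ∈ c, Derives s φ := by
  induction d with
  | hyp h =>
    obtain ⟨s, hs, h⟩ := h
    exact ⟨s, hs, .hyp h⟩
  | ax h =>
    obtain ⟨s, hs⟩ := hne
    exact ⟨s, hs, .ax h⟩
  | mp _ _ ih₁ ih₂ =>
    obtain ⟨s, hs, d₁⟩ := ih₁
    obtain ⟨t, ht, d₂⟩ := ih₂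
    rcases hc.total hs ht with h | h
    · exact ⟨t, ht, .mp (d₁.mono h) d₂⟩
    · exact ⟨s, hs, .mp d₁ (d₂.mono h)⟩

theorem imp_trans (h₁ : Derives Γ (imp φ ψ)) (h₂ : Derives Γ (imp ψ γ)) :
    Derives Γ (imp φ γ) :=
  .mp h₂ (.mp h₁ (.ax (.trans φ ψ γ)))

theorem weaken (φ ψ : FLewForm Var) : Derives Γ (imp φ (imp ψ φ)) :=
  .mp (.ax (.fusLeft φ ψ)) (.ax (.curry φ ψ φ))

theorem exchange (h : Derives Γ (imp φ (imp ψ γ))) : Derives Γ (imp ψ (imp φ γ)) :=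
  .mp (imp_trans (.ax (.fusComm ψ φ)) (.mp h (.ax (.uncurry φ ψ γ)))) (.ax (.curry ψ φ γ))

theorem imp_refl (φ : FLewForm Var) : Derives Γ (imp φ φ) :=
  -- Any derivable formula could serve as the auxiliary antecedent; here it is `φ → (φ → φ)`.
  .mp (weaken φ φ) (exchange (weaken φ (imp φ (imp φ φ))))

theorem imp_of (φ : FLewForm Var) (h : Derives Γ ψ) : Derives Γ (imp φ ψ) :=
  .mp h (weaken ψ φ)

theorem one : Derives Γ (one : FLewForm Var) :=
  .mp (imp_refl zero) (.ax (.toOne _))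

theorem or_inl (β : FLewForm Var) (h : Derives Γ α) : Derives Γ (or α β) :=
  .mp h (.ax (.orLeft α β))

theorem or_inr (α : FLewForm Var) (h : Derives Γ β) : Derives Γ (or α β) :=
  .mp h (.ax (.orRight α β))

theorem or_elim (h₁ : Derives Γ (imp α γ)) (h₂ : Derives Γ (imp β γ)) :
    Derives Γ (imp (or α β) γ) :=
  .mp h₂ (.mp h₁ (.ax (.orElim α β γ)))

/-- Modus ponens inside a disjunction with a fixed right disjunct. -/
theorem or_mp (h₁ : Derives Γ (or φ β)) (h₂ : Derives Γ (or (imp φ ψ) β)) :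
    Derives Γ (or ψ β) := by
  have e₁ : Derives Γ (imp (imp φ ψ) (imp φ (or ψ β))) :=
    .mp (.ax (.orLeft ψ β)) (exchange (.ax (.trans φ ψ (or ψ β))))
  have e₂ : Derives Γ (imp (imp φ (or ψ β)) (imp (or φ β) (or ψ β))) :=
    .mp (.ax (.orRight ψ β)) (exchange (.ax (.orElim φ β (or ψ β))))
  exact .mp h₂ (or_elim (.mp h₁ (exchange (e₁.imp_trans e₂))) (.ax (.orRight ψ β)))

/-- Without contraction the usual deduction theorem fails. Carrying the side disjunct `β` through
every line of the derivation avoids it. -/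
theorem or_right_of_insert (d : Derives (insert α Γ) φ) (h : Derives Γ (or α β)) :
    Derives Γ (or φ β) := by
  induction d with
  | hyp h' =>
    rcases h' with rfl | h'
    · exact h
    · exact or_inl β (.hyp h')
  | ax h' => exact or_inl β (.ax h')
  | mp _ _ ih₁ ih₂ => exact or_mp ih₁ ih₂

/-- Proof by cases from a derivable disjunction. -/
theorem by_cases (h : Derives Γ (or α β)) (h₁ : Derives (insert α Γ) φ)
    (h₂ : Derives (insert β Γ) φ) : Derives Γ φ := by
  -- Replace `α` by `φ` in `α ∨ β` and swap; replacing `β` by `φ` as well then leaves `φ ∨ φ`.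
  have e : Derives Γ (or β φ) :=
    .mp (or_right_of_insert h₁ h) (or_elim (.ax (.orRight _ _)) (.ax (.orLeft _ _)))
  exact .mp (or_right_of_insert h₂ e) (or_elim (imp_refl φ) (imp_refl φ))

end Derives

/-- A set of premises is prime if it derives a disjunct of every disjunction that it derives. -/
def IsPrime (Γ : Set (FLewForm Var)) : Prop :=
  ∀ α β, Derives Γ (or α β) → Derives Γ α ∨ Derives Γ β

/-- Every set of premises that does not derive `φ` extends to a prime one that does not
derive `φ`. -/
theorem exists_isPrime_superset (h : ¬ Derives Γ φ) :
    ∃ Δ, Γ ⊆ Δ ∧ IsPrime Δ ∧ ¬ Derives Δ φ := by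
  obtain ⟨Δ, hΓ, hΔ⟩ := zorn_subset_nonempty {s | ¬ Derives s φ}
    (fun c hc hchain hne => ⟨⋃₀ c, fun d => by
      obtain ⟨s, hs, d⟩ := d.exists_of_sUnion_chain hchain hne
      exact hc hs d, fun s hs => Set.subset_sUnion_of_mem hs⟩) Γ h
  -- By maximality, if adding `α` still does not give `φ`, then `α` already lies in `Δ`.
  have key : ∀ α, ¬ Derives Δ α → Derives (insert α Δ) φ := fun α hα => by
    by_contra hn
    exact hα (.hyp (hΔ.le_of_ge hn (Set.subset_insert α Δ) (Set.mem_insert α Δ)))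
  refine ⟨Δ, hΓ, fun α β d => ?_, hΔ.prop⟩
  by_contra! hn
  exact hΔ.prop (d.by_cases (key α hn.1) (key β hn.2))

theorem Derives.toFLewB (d : Derives Γ φ) :
    FLewBForm.Derives (FLewForm.toFLewB '' Γ) φ.toFLewB := by
  induction d with
  | hyp h => exact .hyp (Set.mem_image_of_mem _ h)
  | ax h => cases h <;> exact .ax (by constructor)
  | mp _ _ ih₁ ih₂ => exact .mp ih₁ ih₂

end FLewForm

namespace FLewBForm

open FLewForm (IsPrime)

variable {Var : Type*} {Γ : Set (FLewForm Var)}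

open Classical in
/-- The translation into `B`-free formulas that replaces, from the inside out, `B φ` by `1` if the
translation of `φ` is derivable from `Γ`, and by `0` otherwise. -/
noncomputable def elimB (Γ : Set (FLewForm Var)) : FLewBForm Var → FLewForm Var
  | var p => .var p
  | zero => .zero
  | one => .one
  | and φ ψ => .and (elimB Γ φ) (elimB Γ ψ)
  | or φ ψ => .or (elimB Γ φ) (elimB Γ ψ)
  | fus φ ψ => .fus (elimB Γ φ) (elimB Γ ψ)
  | imp φ ψ => .imp (elimB Γ φ) (elimB Γ ψ)
  | B φ => if FLewForm.Derives Γ (elimB Γ φ) then .one else .zero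

theorem elimB_toFLewB (Γ : Set (FLewForm Var)) (φ : FLewForm Var) :
    elimB Γ φ.toFLewB = φ := by
  induction φ <;> simp_all [FLewForm.toFLewB, elimB]

theorem elimB_B_of_derives {φ : FLewBForm Var} (h : FLewForm.Derives Γ (elimB Γ φ)) :
    elimB Γ (B φ) = .one :=
  if_pos h

theorem elimB_B_of_not_derives {φ : FLewBForm Var} (h : ¬ FLewForm.Derives Γ (elimB Γ φ)) :
    elimB Γ (B φ) = .zero :=
  if_neg h

theorem derives_elimB_B {φ : FLewBForm Var} (h : FLewForm.Derives Γ (elimB Γ φ)) :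
    FLewForm.Derives Γ (elimB Γ (B φ)) := by
  rw [elimB_B_of_derives h]
  exact .one

/-- To derive the translation of `B φ → ψ`, one may assume that the translation of `φ` is
derivable. -/
theorem derives_elimB_B_imp {φ ψ : FLewBForm Var}
    (h : FLewForm.Derives Γ (elimB Γ φ) → FLewForm.Derives Γ (elimB Γ ψ)) :
    FLewForm.Derives Γ (elimB Γ (imp (B φ) ψ)) := by
  rw [elimB]
  by_cases hφ : FLewForm.Derives Γ (elimB Γ φ)
  · exact .imp_of _ (h hφ)
  · rw [elimB_B_of_not_derives hφ]
    exact .ax (.exFalso _)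

theorem IsAxiom.derives_elimB (hΓ : IsPrime Γ) {φ : FLewBForm Var} (h : IsAxiom φ) :
    FLewForm.Derives Γ (elimB Γ φ) := by
  cases h with
  | B1 φ => exact derives_elimB_B_imp id
  | B2 φ =>
    by_cases hφ : FLewForm.Derives Γ (elimB Γ φ)
    · exact .or_inl _ (derives_elimB_B hφ)
    · refine .or_inr (elimB Γ (B φ)) (β := .imp (elimB Γ (B φ)) .zero) ?_
      -- The right disjunct becomes `0 → 0`.
      rw [elimB_B_of_not_derives hφ]
      exact .imp_refl _
  | B3 φ =>
    refine derives_elimB_B_imp fun h => ?_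
    -- The only use of primeness: it splits the derivable translation of `φ ∨ ¬φ`.
    rcases hΓ _ _ h with hφ | hφ
    · exact .or_inl _ (derives_elimB_B hφ)
    · exact .or_inr _ hφ
  | B4 φ ψ =>
    exact derives_elimB_B_imp fun h => derives_elimB_B_imp fun hφ => derives_elimB_B (.mp hφ h)
  -- `elimB` commutes with the other connectives, so an instance of an FL_ew schema goes to an
  -- instance of the same schema.
  | _ => exact .ax (by constructor)

theorem Derives.elimB (hΓ : IsPrime Γ) {Δ : Set (FLewBForm Var)}
    (hΔ : ∀ ψ ∈ Δ, FLewForm.Derives Γ (elimB Γ ψ)) {φ : FLewBForm Var} (d : Derives Δ φ) :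
    FLewForm.Derives Γ (elimB Γ φ) := by
  induction d with
  | hyp h => exact hΔ _ h
  | ax h => exact h.derives_elimB hΓ
  | mp _ _ ih₁ ih₂ => exact .mp ih₁ ih₂
  | nec _ ih => exact derives_elimB_B ih

end FLewBForm

theorem mainTheorem2 {Var : Type*} (Γ : Set (FLewForm Var)) (φ : FLewForm Var) :
    FLewBForm.Derives (FLewForm.toFLewB '' Γ) φ.toFLewB ↔ FLewForm.Derives Γ φ := by
  refine ⟨fun d => ?_, fun d => d.toFLewB⟩
  by_contra hn
  obtain ⟨Δ, hΓΔ, hΔ, hφ⟩ := FLewForm.exists_isPrime_superset hn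
  refine hφ ?_
  rw [← FLewBForm.elimB_toFLewB Δ φ]
  refine d.elimB hΔ ?_
  rintro _ ⟨ψ, hψ, rfl⟩
  rw [FLewBForm.elimB_toFLewB]
  exact .hyp (hΓΔ hψ)
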